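/- Setting. Let $\mathcal V$ be a finite set of observed variables, each $v\in\mathcal V$ taking values in a countable discrete set. A causal graph is a directed acyclic graph $\mathcal G$ on $\mathcal W=\mathcal V\cup\mathcal U$, where $\mathcal U$ is a set of unobserved variables, none of which has a parent. Two distinct observed variables are joined by a bidirected edge (share an unobserved confounder) if they have a common parent in $\mathcal U$; the directed edges inside $\mathcal V$ together with the bidirected edges form the semi-Markovian graph of $\mathcal G$. A semi-Markovian causal model (SMCM) consists of a causal graph with finitely many unobserved variables, mutually independent unobserved variables with arbitrary laws on arbitrary measurable spaces (joint law $\mathbb P(u)$), and, for each $v\in\mathcal V$, a conditional distribution $\mathbb P(v\mid \pi^{(o)}(v),\pi^{(u)}(v))$ of $v$ given its observed parents $\pi^{(o)}(v)$ and unobserved parents $\pi^{(u)}(v)$. Its observational distribution is $\mathbb P(\mathcal V)=\mathbb E_u\big[\prod_{v\in\mathcal V}\mathbb P(v\mid\pi^{(o)}(v),\pi^{(u)}(v))\big]$, its interventional distribution is $\mathbb P(\mathcal V\mid do(t=t_0))=\mathbf 1_{t=t_0}\,\mathbb E_u\big[\prod_{v\in\mathcal V\setminus\{t\}}\mathbb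 P(v\mid\pi^{(o)}(v),\pi^{(u)}(v))\big]$, and the causal effect $\mathbb P(y\mid do(t=t_0))$ is obtained from the latter by summing over all observed variables other than $y$. Given a causal graph $\mathcal G$ and a distribution $\mathbb P(\mathcal V)$, the causal effect of $t$ on $y$ is identifiable if, for all values $t_0$ of $t$ and $y_0$ of $y$, $\mathbb P(y=y_0\mid do(t=t_0))$ is identical for all SMCMs that have the semi-Markovian graph of $\mathcal G$ and the observational distribution $\mathbb P(\mathcal V)$. A path in $\mathcal G$ is a sequence of distinct vertices of $\mathcal W$, consecutive ones being joined by an edge. It is blocked by a set $C$ if it has an inner vertex that is a non-collider and lies in $C$, or an inner vertex that is a collider such that neither it nor any of its descendants lies in $C$. Sets $A_1$ and $A_2$ are d-separated by $C$ if $C$ blocks every path from a vertex of $A_1$ to a vertex of $A_2$. Theorem 1 (Causal Identifiability). Let $\mathcal G$ be any causal graph over $\mathcal V$, let $t,y\in\mathcal V$, and let $\mathbb P(\mathcal V)$ be a strictly positive distribution. Assume that (1) the outcome $y$ is a descendant of the treatment $t$ in $\mathcal G$; (2) $t$ and $y$ share an unobserved confounder; (3) $b\subseteq\mathcal V$ is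 the set of all children of $t$. If there exists a set $z\subseteq\mathcal V\setminus(\{t,y\}\cup b)$ such that $b$ and $y$ are d-separated by $\{t\}\cup z$ in $\mathcal G$, then the causal effect of $t$ on $y$ is identifiable. -/

import Mathlib

open MeasureTheory
open scoped ENNReal

universe uV uU uS uN uL

/-- A causal graph: a directed acyclic graph whose vertices are the observed variables `V`
(as `Sum.inl v`) and the unobserved variables `U` (as `Sum.inr q`), in which no unobserved
variable has a parent. -/
structure CausalGraph (V : Type uV) (U : Type uU) extends Digraph (V ⊕ U) where
  acyclic : ∀ w, ¬ Relation.TransGen Adj w w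
  latent_root : ∀ w q, ¬ Adj w (Sum.inr q)

namespace CausalGraph

variable {V : Type uV} {U : Type uU} (G : CausalGraph V U)

/-- The set of (observed) children of `t`; by `latent_root` every child is observed. -/
def children (t : V) : Set V := {v | G.Adj (Sum.inl t) (Sum.inl v)}

/-- `d` is a proper descendant of `a`. -/
def IsDescendant (d a : V ⊕ U) : Prop := Relation.TransGen G.Adj a d

/-- Two distinct observed variables have a common unobserved parent, i.e. they are joined by a
bidirected edge of the semi-Markovian graph. -/
def Bidirected (v w : V) : Prop :=
  v ≠ w ∧ ∃ q : U, G.Adj (Sum.inr q) (Sum.inl v) ∧ G.Adj (Sum.inr q) (Sum.inl w)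

/-- Two causal graphs over the same observed variables, possibly with different unobserved
variables, represent the same semi-Markovian graph: the same directed edges between observed
variables and the same bidirected edges. -/
def SameSemiMarkovian {U' : Type*} (G' : CausalGraph V U') : Prop :=
  (∀ v w : V, G.Adj (Sum.inl v) (Sum.inl w) ↔ G'.Adj (Sum.inl v) (Sum.inl w)) ∧
    ∀ v w : V, G.Bidirected v w ↔ G'.Bidirected v w

/-- The underlying undirected graph. -/
def skeleton : SimpleGraph (V ⊕ U) where
  Adj a b := G.Adj a b ∨ G.Adj b a
  symm := ⟨fun _ _ h => h.symm⟩
  loopless := ⟨fun a h => G.acyclic a (Relation.TransGen.single (h.elim id id))⟩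

/-- The consecutive vertices `a`, `w`, `c` of a path form a collider at `w`: `a → w ← c`. -/
def IsCollider (a w c : V ⊕ U) : Prop := G.Adj a w ∧ G.Adj c w

/-- The walk `p` is blocked by `C`: it has an inner vertex `w` that is a non-collider in `C`, or
that is a collider such that neither `w` nor any descendant of `w` is in `C`. -/
def Blocked (C : Set (V ⊕ U)) {a b : V ⊕ U} (p : G.skeleton.Walk a b) : Prop :=
  ∃ l w r, [l, w, r] <:+: p.support ∧
    ((¬ G.IsCollider l w r ∧ w ∈ C) ∨
      (G.IsCollider l w r ∧ w ∉ C ∧ ∀ d, G.IsDescendant d w → d ∉ C))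

/-- `C` d-separates `A` from `B`: it blocks every path (without repeated vertices) from a vertex
of `A` to a vertex of `B`. -/
def DSep (A B C : Set (V ⊕ U)) : Prop :=
  ∀ a ∈ A, ∀ b ∈ B, ∀ p : G.skeleton.Walk a b, p.IsPath → G.Blocked C p

end CausalGraph

/-- A semi-Markovian causal model over the observed variables `V`, the variable `v` having the
discrete state space `S v`. The unobserved variables are the (parentless) roots of the graph, so
they are mutually independent, with arbitrary laws on arbitrary measurable spaces. -/
structure SMCM (V : Type uV) (S : V → Type uS) where
  /-- the unobserved variables -/
  Latent : Type uN
  [latentFintype : Fintype Latent]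
  /-- the causal graph -/
  graph : CausalGraph V Latent
  /-- the state spaces of the unobserved variables -/
  LatentSpace : Latent → Type uL
  [latentMeasurable : ∀ q, MeasurableSpace (LatentSpace q)]
  /-- the laws of the unobserved variables -/
  latentLaw : ∀ q, Measure (LatentSpace q)
  [latentProb : ∀ q, IsProbabilityMeasure (latentLaw q)]
  /-- the conditional law of `v` given its parents, written as a function of all variables ... -/
  cond : ∀ v, (∀ w, S w) → (∀ q, LatentSpace q) → PMF (S v)
  /-- ... which depends only on the observed and the unobserved parents of `v` -/
  cond_congr : ∀ v (x x' : ∀ w, S w) (u u' : ∀ q, LatentSpace q),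
    (∀ w, graph.Adj (Sum.inl w) (Sum.inl v) → x w = x' w) →
    (∀ q, graph.Adj (Sum.inr q) (Sum.inl v) → u q = u' q) →
    cond v x u = cond v x' u'
  cond_measurable : ∀ v x a, Measurable fun u => cond v x u a

namespace SMCM

attribute [instance] SMCM.latentFintype SMCM.latentMeasurable SMCM.latentProb

variable {V : Type uV} [Fintype V] [DecidableEq V] {S : V → Type uS}

/-- The joint law of the unobserved variables. -/
noncomputable def latentJoint (M : SMCM.{uV, uS, uN, uL} V S) :
    Measure (∀ q, M.LatentSpace q) :=
  Measure.pi M.latentLaw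

/-- The observational distribution, as a probability mass function. -/
noncomputable def obs (M : SMCM.{uV, uS, uN, uL} V S) (x : ∀ v, S v) : ℝ≥0∞ :=
  ∫⁻ u, ∏ v, M.cond v x u (x v) ∂M.latentJoint

/-- The interventional distribution of all observed variables under `do(t = t₀)`. -/
noncomputable def doDist (M : SMCM.{uV, uS, uN, uL} V S) (t : V) (t₀ : S t) :
    (∀ v, S v) → ℝ≥0∞ :=
  Set.indicator {x | x t = t₀}
    fun x => ∫⁻ u, ∏ v ∈ Finset.univ.erase t, M.cond v x u (x v) ∂M.latentJoint

/-- The causal effect `P(y = y₀ | do(t = t₀))`: the interventional distribution with all variables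
except `y` summed out. -/
noncomputable def causalEffect (M : SMCM.{uV, uS, uN, uL} V S) (t : V) (t₀ : S t)
    (y : V) (y₀ : S y) : ℝ≥0∞ :=
  ∑' x : {x : ∀ v, S v // x y = y₀}, M.doDist t t₀ x

end SMCM

/-- The causal effect of `t` on `y` is identifiable from the causal graph `G` and the observational
distribution `P`: it is the same for all semi-Markovian causal models with the semi-Markovian
graph of `G` and the observational distribution `P`. -/
def Identifiable {V : Type uV} [Fintype V] [DecidableEq V] {S : V → Type uS} {U : Type uU}
    (G : CausalGraph V U) (P : PMF (∀ v, S v)) (t y : V) : Prop :=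
  ∀ M₁ M₂ : SMCM.{uV, uS, uN, uL} V S,
    G.SameSemiMarkovian M₁.graph → G.SameSemiMarkovian M₂.graph →
    (∀ x, M₁.obs x = P x) → (∀ x, M₂.obs x = P x) →
    ∀ (t₀ : S t) (y₀ : S y), M₁.causalEffect t t₀ y y₀ = M₂.causalEffect t t₀ y y₀

/-!
The proof has a graphical and a probabilistic half, which meet in the c-component `T` of `t` in the
set `D` of ancestors of `y`: the set of vertices that bidirected edges between members of `D`
connect to `t`.

*Graph.* No child of `t` lies in `T`. For a child `v` in `T`, follow the bidirected path from `v`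
towards `t` as far as its vertices lie in the conditioning set or have descendants in it; they are
open colliders. At the first other vertex, a directed path leads on to `y`, none of
whose vertices is in the conditioning set; if there is none, the bidirected edge between `t` and
`y` is the last step (`CausalGraph.exists_activeWalk_of_bidirected`). This is an unblocked walk
from a child of `t` to `y`, possibly with repeated vertices. Cutting out the loops keeps it
unblocked (`CausalGraph.ActiveWalk.cut`), which contradicts the d-separation.

*Probability.* For a set `A` of observed variables let the c-factor `Q[A]` be the expectation of
the product of the conditional laws of the members of `A`. Summing out a variable without children
in `A` removes it from `A` (`SMCM.tsum_cFactor_insert`), so the observational distribution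
determines `Q[A]` for all ancestral `A`. By independence of the latent variables,
`Q[A ∪ B] = Q[A] Q[B]` if no bidirected edge joins `A` and `B` (`SMCM.cFactor_union`). Adding the
variables in topological order and dividing, one finds that `Q[T]` and `Q[D \ T]` are determined
by the positive observational distribution (`SMCM.cFactor_filter_eq`). As `t` has no children in
`T`, `Q[T \ {t}]` is the sum of `Q[T]` over the values of `t`, so
`Q[D \ {t}] = Q[T \ {t}] Q[D \ T]` is determined as well, and the causal effect is a sum of its
values (`SMCM.causalEffect_eq_tsum`).
-/

/-! ### Active walks and d-separation -/

namespace CausalGraph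

section ActiveWalks

variable {V : Type uV} {U : Type uU} (G : CausalGraph V U) (C : Set (V ⊕ U))

/-- `w` or one of its descendants lies in `C`. -/
def HasDescendantIn (w : V ⊕ U) : Prop := ∃ d ∈ C, Relation.ReflTransGen G.Adj w d

/-- A walk through the consecutive vertices `l`, `w`, `r` is not blocked by `C` at `w`. -/
def OpenAt (l w r : V ⊕ U) : Prop :=
  (G.IsCollider l w r → G.HasDescendantIn C w) ∧ (¬ G.IsCollider l w r → w ∉ C)

/-- The list of vertices is a walk in the skeleton, possibly with repeated vertices, that `C` does
not block. -/
def ActiveWalk : List (V ⊕ U) → Prop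
  | [] => True
  | [_] => True
  | [a, b] => G.skeleton.Adj a b
  | a :: b :: c :: L => G.skeleton.Adj a b ∧ G.OpenAt C a b c ∧ ActiveWalk (b :: c :: L)

variable {G C}

theorem HasDescendantIn.of_adj {a b : V ⊕ U} (h : G.Adj a b) (hb : G.HasDescendantIn C b) :
    G.HasDescendantIn C a := by
  obtain ⟨d, hd, hbd⟩ := hb
  exact ⟨d, hd, .head h hbd⟩

namespace ActiveWalk

theorem tail {a : V ⊕ U} : ∀ {L : List (V ⊕ U)}, G.ActiveWalk C (a :: L) → G.ActiveWalk C L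
  | [], _ => trivial
  | [_], _ => trivial
  | _ :: _ :: _, h => h.2.2

theorem adj {a b : V ⊕ U} : ∀ {L : List (V ⊕ U)}, G.ActiveWalk C (a :: b :: L) →
    G.skeleton.Adj a b
  | [], h => h
  | _ :: _, h => h.1

theorem right : ∀ (L : List (V ⊕ U)) {M : List (V ⊕ U)}, G.ActiveWalk C (L ++ M) →
    G.ActiveWalk C M
  | [], _, h => h
  | _ :: L, _, h => right L h.tail

theorem left : ∀ {L : List (V ⊕ U)} (M : List (V ⊕ U)), G.ActiveWalk C (L ++ M) →
    G.ActiveWalk C L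
  | [], _, _ => trivial
  | [_], _, _ => trivial
  | [_, _], _, h => h.adj
  | _ :: _ :: _ :: _, M, h => ⟨h.1, h.2.1, left M h.2.2⟩

theorem isChain : ∀ {L : List (V ⊕ U)}, G.ActiveWalk C L → L.IsChain G.skeleton.Adj
  | [], _ => .nil
  | [_], _ => .singleton _
  | _ :: _ :: _, h => .cons_cons h.adj h.tail.isChain

theorem openAt {l w r : V ⊕ U} {L : List (V ⊕ U)} (h : G.ActiveWalk C L)
    (hL : [l, w, r] <:+: L) : G.OpenAt C l w r := by
  obtain ⟨s, e, rfl⟩ := hL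
  rw [List.append_assoc] at h
  exact (h.right).2.1

/-- Two active walks that meet at `w` join to an active walk if the vertices next to `w` leave
it open. -/
theorem glue {w : V ⊕ U} {R : List (V ⊕ U)} (hR : G.ActiveWalk C (w :: R)) :
    ∀ {L : List (V ⊕ U)}, G.ActiveWalk C (L ++ [w]) →
      (∀ l ∈ L.getLast?, ∀ r ∈ R.head?, G.OpenAt C l w r) → G.ActiveWalk C (L ++ w :: R)
  | [], _, _ => hR
  | [l], hL, h => by
    cases R with
    | nil => exact hL
    | cons r R => exact ⟨hL.adj, h l rfl r rfl, hR⟩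
  | [a, l], hL, h => ⟨hL.adj, hL.2.1, glue (L := [l]) hR hL.tail (by simpa using h)⟩
  | a :: b :: l :: L, hL, h => ⟨hL.adj, hL.2.1, glue (L := b :: l :: L) hR hL.tail
      (by simpa [List.getLast?_cons_cons] using h)⟩

/-- An active walk that starts along a directed edge keeps descending until it meets a collider,
which is open, so that its first vertex has a descendant in `C`. -/
theorem hasDescendantIn_or_transGen {a b : V ⊕ U} (hab : G.Adj a b) :
    ∀ {L : List (V ⊕ U)}, G.ActiveWalk C (a :: b :: L) →
      G.HasDescendantIn C a ∨ ∀ w ∈ b :: L, Relation.TransGen G.Adj a w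
  | [], _ => .inr (by simpa using .single hab)
  | c :: L, h => by
    rcases h.tail.adj with hbc | hcb
    · rcases hasDescendantIn_or_transGen hbc h.tail with hb | hb
      · exact .inl (hb.of_adj hab)
      · right
        intro w hw
        rcases List.mem_cons.1 hw with rfl | hw
        · exact .single hab
        · exact .head hab (hb w hw)
    · exact .inl ((h.2.1.1 ⟨hab, hcb⟩).of_adj hab)

/-- Cutting a loop out of an active walk leaves an active walk. If the vertex `w` of the loop
becomes a collider without having been one, the loop starts downwards at `w` and, as it cannot
return to `w` along directed edges, it runs into a collider below `w`. -/
theorem cut {w : V ⊕ U} {L M R : List (V ⊕ U)} (h : G.ActiveWalk C (L ++ w :: (M ++ w :: R))) :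
    G.ActiveWalk C (L ++ w :: R) := by
  have hR : G.ActiveWalk C (w :: R) := right (w :: M) h.right
  have hL : G.ActiveWalk C (L ++ [w]) := left (M ++ w :: R) (by simpa using h)
  refine glue hR hL fun l hl r hr => ?_
  obtain ⟨L, rfl⟩ : ∃ L', L = L' ++ [l] := by
    rcases List.eq_nil_or_concat L with rfl | ⟨L', x, rfl⟩
    · simp at hl
    · exact ⟨L', by simpa using hl⟩
  obtain ⟨R, rfl⟩ : ∃ R', R = r :: R' := by
    cases R with
    | nil => simp at hr
    | cons x R => exact ⟨R, by simpa using hr⟩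
  cases M with
  | nil =>
    have hw : G.skeleton.Adj w w := h.right.adj
    exact absurd hw (SimpleGraph.irrefl _)
  | cons m M =>
    have hm : G.OpenAt C l w m :=
      h.openAt ⟨L, M ++ w :: r :: R, by simp⟩
    obtain ⟨m', M', hM'⟩ : ∃ m' M', m :: M = M' ++ [m'] := by
      rcases List.eq_nil_or_concat (m :: M) with h0 | ⟨M', x, h0⟩
      · simp at h0
      · exact ⟨x, M', by simpa using h0⟩
    have hm' : G.OpenAt C m' w r :=
      h.openAt ⟨L ++ [l, w] ++ M', R, by rw [hM']; simp⟩
    refine ⟨fun hc => ?_, fun hc hw => ?_⟩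
    · have hloop : G.ActiveWalk C (w :: m :: (M ++ w :: r :: R)) := h.right
      rcases hloop.adj with hd | hu
      · rcases hasDescendantIn_or_transGen hd hloop with h1 | h1
        · exact h1
        · exact absurd (h1 w (by simp)) (G.acyclic w)
      · exact hm.1 ⟨hc.1, hu⟩
    · exact hc ⟨(not_not.1 (mt hm.2 (not_not.2 hw))).1, (not_not.1 (mt hm'.2 (not_not.2 hw))).2⟩

/-- An active walk contains an active path with the same ends. -/
theorem exists_nodup {a b : V ⊕ U} {L : List (V ⊕ U)} (hL : G.ActiveWalk C L)
    (ha : a ∈ L.head?) (hb : b ∈ L.getLast?) :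
    ∃ L', G.ActiveWalk C L' ∧ L'.Nodup ∧ a ∈ L'.head? ∧ b ∈ L'.getLast? := by
  induction hn : L.length using Nat.strong_induction_on generalizing L with
  | _ n ih =>
    by_cases hnd : L.Nodup
    · exact ⟨L, hL, hnd, ha, hb⟩
    obtain ⟨w, hw⟩ := List.exists_duplicate_iff_not_nodup.2 hnd
    obtain ⟨L₁, L₂, L₃, rfl⟩ : ∃ L₁ L₂ L₃, L = L₁ ++ w :: (L₂ ++ w :: L₃) := by
      clear * - hw
      induction hw with
      | cons_mem h =>
        obtain ⟨s, e, rfl⟩ := List.append_of_mem h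
        exact ⟨[], s, e, rfl⟩
      | @cons_duplicate x l h ih =>
        obtain ⟨L₁, L₂, L₃, rfl⟩ := ih
        exact ⟨x :: L₁, L₂, L₃, rfl⟩
    refine ih (L₁ ++ w :: L₃).length ?_ hL.cut ?_ ?_ rfl
    · simp at hn ⊢; omega
    · cases L₁ <;> simpa using ha
    · cases L₃ <;> simpa [List.getLast?_append, List.getLast?_cons] using hb

end ActiveWalk

/-- A d-separating set blocks not only the paths but all walks. -/
theorem DSep.not_activeWalk {A B : Set (V ⊕ U)} (h : G.DSep A B C) {a b : V ⊕ U} (ha : a ∈ A)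
    (hb : b ∈ B) {L : List (V ⊕ U)} (hLa : a ∈ L.head?) (hLb : b ∈ L.getLast?) :
    ¬ G.ActiveWalk C L := by
  intro hL
  obtain ⟨L, hL, hnd, hLa, hLb⟩ := hL.exists_nodup hLa hLb
  have hne : L ≠ [] := by rintro rfl; simp at hLa
  obtain rfl : L.head hne = a := by
    simpa [List.head?_eq_some_head hne] using hLa
  obtain rfl : L.getLast hne = b := by
    simpa [List.getLast?_eq_some_getLast hne] using hLb
  obtain ⟨l, w, r, hi, hblock⟩ := h _ ha _ hb (.ofSupport L hne hL.isChain)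
    (by rw [SimpleGraph.Walk.isPath_def, SimpleGraph.Walk.support_ofSupport]; exact hnd)
  rw [SimpleGraph.Walk.support_ofSupport] at hi
  rcases hblock with ⟨hc, hw⟩ | ⟨hc, hw, hd⟩
  · exact (hL.openAt hi).2 hc hw
  · obtain ⟨d, hdC, hwd⟩ := (hL.openAt hi).1 hc
    rcases Relation.reflTransGen_iff_eq_or_transGen.1 hwd with rfl | hwd
    · exact hw hdC
    · exact hd d hwd hdC

/-- A directed path from `v` to `y`, no vertex of which has a descendant in `C`, extends an edge
`q → v` to an active walk. -/
theorem exists_activeWalk_of_reflTransGen {q v y : V ⊕ U} (hq : G.Adj q v)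
    (hvy : Relation.ReflTransGen G.Adj v y) (hv : ¬ G.HasDescendantIn C v) :
    ∃ L, G.ActiveWalk C (q :: v :: L) ∧ y ∈ (v :: L).getLast? := by
  induction hvy using Relation.ReflTransGen.head_induction_on generalizing q with
  | refl => exact ⟨[], .inl hq, rfl⟩
  | @head v w hvw hwy ih =>
    obtain ⟨L, hL, hy⟩ := ih hvw fun hw => hv (hw.of_adj hvw)
    refine ⟨w :: L, ⟨.inl hq, ⟨fun hc => ?_, fun _ hvC => hv ⟨v, hvC, .refl⟩⟩, hL⟩, ?_⟩
    · exact absurd (.tail (.single hvw) hc.2) (G.acyclic v)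
    · simpa [List.getLast?_cons_cons] using hy

/-- Let `t` be joined to `y` by a bidirected edge. If a bidirected path through ancestors of `y`
leads from `t` to `v`, then `v` has an active walk to `y` that leaves `v` through a latent parent:
the bidirected path is followed from `v` to the next vertex that has no descendant in `C` and is
not in `C` itself, and from there a directed path to `y`; if there is no such vertex, it is
followed to `t` and then along the bidirected edge to `y`. -/
theorem exists_activeWalk_of_bidirected {C : Set V} {t y v : V}
    (hty : G.Bidirected t y)
    (hv : Relation.ReflTransGen (fun a b => G.Bidirected a b ∧
      Relation.ReflTransGen G.Adj (Sum.inl a) (Sum.inl y)) t v) :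
    ∃ q L, G.Adj (Sum.inr q) (Sum.inl v) ∧
      G.ActiveWalk (Sum.inl '' C) (Sum.inl v :: Sum.inr q :: L) ∧
      Sum.inl y ∈ (Sum.inr q :: L).getLast? := by
  have latent_open : ∀ (a b : V ⊕ U) (q : U), G.OpenAt (Sum.inl '' C) a (Sum.inr q) b :=
    fun a b q => ⟨fun h => absurd h.1 (G.latent_root _ _), by simp⟩
  induction hv with
  | refl =>
    obtain ⟨-, q, hqt, hqy⟩ := hty
    exact ⟨q, [Sum.inl y], hqt, ⟨.inr hqt, latent_open _ _ _, .inl hqy⟩, rfl⟩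
  | @tail a b _ hab ih =>
    obtain ⟨⟨-, p, hpa, hpb⟩, hay⟩ := hab
    obtain ⟨q, L, hqa, hL, hy⟩ := ih
    by_cases ha : G.HasDescendantIn (Sum.inl '' C) (Sum.inl a)
    · refine ⟨p, Sum.inl a :: Sum.inr q :: L, hpb, ⟨.inr hpb, latent_open _ _ _, .inl hpa,
        ⟨fun _ => ha, fun h => absurd ⟨hpa, hqa⟩ h⟩, hL⟩, ?_⟩
      simpa [List.getLast?_cons_cons] using hy
    · obtain ⟨L', hL', hy'⟩ := exists_activeWalk_of_reflTransGen hpa hay ha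
      exact ⟨p, Sum.inl a :: L', hpb, ⟨.inr hpb, latent_open _ _ _, hL'⟩,
        by simpa [List.getLast?_cons_cons] using hy'⟩

end ActiveWalks

end CausalGraph

/-! ### Ancestral sets -/

namespace CausalGraph

variable {V : Type uV} {U : Type uU} (G : CausalGraph V U)

/-- The set `A` of observed variables contains the observed parents of each of its members. -/
def Ancestral (A : Finset V) : Prop :=
  ∀ w ∈ A, ∀ v, G.Adj (Sum.inl v) (Sum.inl w) → v ∈ A

variable {G}

theorem wellFounded_transGen [Finite V] :
    WellFounded fun v w : V => Relation.TransGen G.Adj (Sum.inl v) (Sum.inl w) :=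
  haveI : IsTrans V fun v w => Relation.TransGen G.Adj (Sum.inl v) (Sum.inl w) :=
    ⟨fun _ _ _ => Relation.TransGen.trans⟩
  haveI : Std.Irrefl fun v w : V => Relation.TransGen G.Adj (Sum.inl v) (Sum.inl w) :=
    ⟨fun v => G.acyclic (Sum.inl v)⟩
  Finite.wellFounded_of_trans_of_irrefl _

theorem wellFounded_swap_transGen [Finite V] :
    WellFounded fun v w : V => Relation.TransGen G.Adj (Sum.inl w) (Sum.inl v) :=
  haveI : IsTrans V fun v w => Relation.TransGen G.Adj (Sum.inl w) (Sum.inl v) :=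
    ⟨fun _ _ _ h h' => h'.trans h⟩
  haveI : Std.Irrefl fun v w : V => Relation.TransGen G.Adj (Sum.inl w) (Sum.inl v) :=
    ⟨fun v => G.acyclic (Sum.inl v)⟩
  Finite.wellFounded_of_trans_of_irrefl _

variable [Fintype V] [DecidableEq V]

theorem Ancestral.exists_insert {A : Finset V} (hA : G.Ancestral A) (hne : A ≠ Finset.univ) :
    ∃ v ∉ A, G.Ancestral (insert v A) := by
  obtain ⟨v, hv, hmin⟩ := G.wellFounded_transGen.has_min {v | v ∉ A}
    (by simpa [Finset.eq_univ_iff_forall, Set.Nonempty] using hne)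
  refine ⟨v, hv, fun w hw u hu => ?_⟩
  rcases Finset.mem_insert.1 hw with rfl | hw
  · exact Finset.mem_insert_of_mem (not_not.1 fun h => hmin u h (.single hu))
  · exact Finset.mem_insert_of_mem (hA w hw u hu)

/-- Downward induction on ancestral sets: observed variables are removed in reverse topological
order. -/
theorem Ancestral.induction_down {p : Finset V → Prop} (univ : p Finset.univ)
    (step : ∀ (A : Finset V) (v : V), v ∉ A → G.Ancestral A → G.Ancestral (insert v A) →
      p (insert v A) → p A) {A : Finset V} (hA : G.Ancestral A) : p A := by
  induction hn : (Finset.univ \ A).card using Nat.strong_induction_on generalizing A with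
  | _ n ih =>
    by_cases hne : A = Finset.univ
    · exact hne ▸ univ
    obtain ⟨v, hv, hvA⟩ := hA.exists_insert hne
    refine step A v hv hA hvA (ih _ ?_ hvA rfl)
    rw [← hn]
    refine Finset.card_lt_card
      (Finset.ssubset_iff_of_subset ?_ |>.2 ⟨v, by simpa using hv, by simp⟩)
    exact Finset.sdiff_subset_sdiff subset_rfl (Finset.subset_insert _ _)

/-- Upward induction on ancestral sets: observed variables are added in topological order. -/
theorem Ancestral.induction_up {p : Finset V → Prop} (empty : p ∅)
    (step : ∀ (A : Finset V) (v : V), v ∉ A → G.Ancestral A → G.Ancestral (insert v A) →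
      p A → p (insert v A)) {A : Finset V} (hA : G.Ancestral A) : p A := by
  induction hn : A.card using Nat.strong_induction_on generalizing A with
  | _ n ih =>
    rcases A.eq_empty_or_nonempty with rfl | hne
    · exact empty
    obtain ⟨v, hv, hmax⟩ := G.wellFounded_swap_transGen.has_min (A : Set V) hne
    have hvA : G.Ancestral (A.erase v) := fun w hw u hu =>
      Finset.mem_erase.2 ⟨fun h => hmax w (Finset.mem_of_mem_erase hw) (.single (h ▸ hu)),
        hA w (Finset.mem_of_mem_erase hw) u hu⟩
    have := step (A.erase v) v (Finset.notMem_erase _ _) hvA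
      (by rwa [Finset.insert_erase hv])
      (ih _ (by rw [← hn]; exact Finset.card_erase_lt_of_mem hv) hvA rfl)
    rwa [Finset.insert_erase hv] at this

end CausalGraph

/-! ### c-factors of a model -/

namespace SMCM

variable {V : Type uV} {S : V → Type uS}

/-- The c-factor of a set `A` of observed variables: the probability of the values of `A` in `x`
when all other observed variables are set to their values in `x`. -/
noncomputable def cFactor (M : SMCM.{uV, uS, uN, uL} V S) (A : Finset V) (x : ∀ v, S v) : ℝ≥0∞ :=
  ∫⁻ u, ∏ v ∈ A, M.cond v x u (x v) ∂Measure.pi M.latentLaw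

variable (M : SMCM.{uV, uS, uN, uL} V S)

theorem measurable_prod_cond (A : Finset V) (x : ∀ v, S v) :
    Measurable fun u => ∏ v ∈ A, M.cond v x u (x v) :=
  Finset.measurable_fun_prod _ fun v _ => M.cond_measurable v x (x v)

theorem cFactor_le_one (A : Finset V) (x : ∀ v, S v) : M.cFactor A x ≤ 1 := by
  calc M.cFactor A x ≤ ∫⁻ _, 1 ∂Measure.pi M.latentLaw :=
        lintegral_mono fun u => Finset.prod_le_one' fun v _ => (M.cond v x u).coe_le_one _
    _ = 1 := by simp

variable [DecidableEq V]

theorem prod_cond_update {A : Finset V} {v : V} (hvA : v ∉ A)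
    (hch : ∀ w ∈ A, ¬ M.graph.Adj (Sum.inl v) (Sum.inl w)) (x : ∀ v, S v) (a : S v)
    (u : ∀ q, M.LatentSpace q) :
    ∏ w ∈ A, M.cond w (Function.update x v a) u (Function.update x v a w) =
      ∏ w ∈ A, M.cond w x u (x w) := by
  refine Finset.prod_congr rfl fun w hw => ?_
  rw [Function.update_of_ne (ne_of_mem_of_not_mem hw hvA)]
  rw [M.cond_congr w (Function.update x v a) x u u (fun s hs => ?_) fun _ _ => rfl]
  exact Function.update_of_ne (by rintro rfl; exact hch w hw hs) _ _

theorem cFactor_update {A : Finset V} {v : V} (hvA : v ∉ A)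
    (hch : ∀ w ∈ A, ¬ M.graph.Adj (Sum.inl v) (Sum.inl w)) (x : ∀ v, S v) (a : S v) :
    M.cFactor A (Function.update x v a) = M.cFactor A x := by
  simp only [cFactor, M.prod_cond_update hvA hch]

/-- Summing out a variable without children in `A` removes it from the c-factor. -/
theorem tsum_cFactor_insert {A : Finset V} {v : V} [Countable (S v)] (hvA : v ∉ A)
    (hch : ∀ w ∈ A, ¬ M.graph.Adj (Sum.inl v) (Sum.inl w)) (x : ∀ v, S v) :
    ∑' a, M.cFactor (insert v A) (Function.update x v a) = M.cFactor A x := by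
  unfold cFactor
  rw [← lintegral_tsum fun a => (M.measurable_prod_cond _ _).aemeasurable]
  refine lintegral_congr fun u => ?_
  simp only [Finset.prod_insert hvA, M.prod_cond_update hvA hch, Function.update_self]
  rw [ENNReal.tsum_mul_right]
  have hv : ∀ a, M.cond v (Function.update x v a) u = M.cond v x u := fun a =>
    M.cond_congr v _ _ u u (fun s hs => Function.update_of_ne
      (by rintro rfl; exact M.graph.acyclic _ (.single hs)) _ _) fun _ _ => rfl
  simp only [hv, (M.cond v x u).tsum_coe, one_mul]

/-- The c-factor of a union of two sets that no bidirected edge joins is the product of their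
c-factors, because the factors under the integral depend on disjoint sets of latent variables. -/
theorem cFactor_union {A B : Finset V} (hAB : Disjoint A B)
    (h : ∀ v ∈ A, ∀ w ∈ B, ¬ M.graph.Bidirected v w) (x : ∀ v, S v) :
    M.cFactor (A ∪ B) x = M.cFactor A x * M.cFactor B x := by
  classical
  let L (A : Finset V) : Finset M.Latent :=
    Finset.univ.filter fun q => ∃ v ∈ A, M.graph.Adj (Sum.inr q) (Sum.inl v)
  have hL : Disjoint (L A) (L B) := by
    refine Finset.disjoint_left.2 fun q hqA hqB => ?_
    obtain ⟨v, hv, hqv⟩ := (Finset.mem_filter.1 hqA).2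
    obtain ⟨w, hw, hqw⟩ := (Finset.mem_filter.1 hqB).2
    exact h v hv w hw ⟨(hAB.forall_ne_finset hv hw), q, hqv, hqw⟩
  have hne : ∀ q, Nonempty (M.LatentSpace q) := fun q => (M.latentLaw q).nonempty_of_neZero
  let u₀ : ∀ q, M.LatentSpace q := fun q => (hne q).some
  -- the latent variables outside `s` are irrelevant and are set to the values of `u₀`
  let ext (s : Finset M.Latent) (u : ∀ q : s, M.LatentSpace q) (q : M.Latent) : M.LatentSpace q :=
    if hq : q ∈ s then u ⟨q, hq⟩ else u₀ q
  have hext : ∀ s, Measurable (ext s) := by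
    intro s
    refine measurable_pi_lambda _ fun q => ?_
    by_cases hq : q ∈ s
    · simpa only [ext, hq, dite_true] using measurable_pi_apply _
    · simpa only [ext, hq, dite_false] using measurable_const
  have hfac : ∀ (A : Finset V) u, ∏ v ∈ A, M.cond v x u (x v) =
      ∏ v ∈ A, M.cond v x (ext (L A) fun q => u q) (x v) := by
    refine fun A u => Finset.prod_congr rfl fun v hv => ?_
    rw [M.cond_congr v x x u (ext (L A) fun q => u q) (fun _ _ => rfl) fun q hq => ?_]
    have : q ∈ L A := Finset.mem_filter.2 ⟨Finset.mem_univ _, v, hv, hq⟩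
    simp [ext, this]
  have hind : ProbabilityTheory.iIndepFun (fun q (u : ∀ q, M.LatentSpace q) => u q)
      (Measure.pi M.latentLaw) :=
    ProbabilityTheory.iIndepFun_pi (X := fun q (a : M.LatentSpace q) => a)
      fun q => aemeasurable_id
  have hind2 := (hind.indepFun_finset (L A) (L B) hL fun q => measurable_pi_apply q).comp
    ((M.measurable_prod_cond A x).comp (hext (L A)))
    ((M.measurable_prod_cond B x).comp (hext (L B)))
  have hA : (fun u => ∏ v ∈ A, M.cond v x u (x v)) =
    ((fun u => ∏ v ∈ A, M.cond v x u (x v)) ∘ ext (L A)) ∘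
      fun u (q : L A) => u q := funext (hfac A)
  have hB : (fun u => ∏ v ∈ B, M.cond v x u (x v)) =
    ((fun u => ∏ v ∈ B, M.cond v x u (x v)) ∘ ext (L B)) ∘
      fun u (q : L B) => u q := funext (hfac B)
  rw [← hA, ← hB] at hind2
  simp only [cFactor, Finset.prod_union hAB]
  exact ProbabilityTheory.lintegral_mul_eq_lintegral_mul_lintegral_of_indepFun
    (M.measurable_prod_cond A x) (M.measurable_prod_cond B x) hind2

end SMCM

/-! ### Comparison of two models with the same observational distribution -/

namespace SMCM

variable {V : Type uV} {U : Type uU} {S : V → Type uS}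
  {G : CausalGraph V U} {M M₁ M₂ : SMCM.{uV, uS, uN, uL} V S}

theorem not_adj_of_ancestral (h : G.SameSemiMarkovian M.graph) {A : Finset V}
    (hA : G.Ancestral A) {v : V} (hv : v ∉ A) :
    ∀ w ∈ A, ¬ M.graph.Adj (Sum.inl v) (Sum.inl w) :=
  fun w hw hvw => hv (hA w hw v ((h.1 v w).2 hvw))

/-- In a product of c-factors, a known positive factor determines the other one. -/
theorem cFactor_left_eq [DecidableEq V] {A B : Finset V} (hAB : Disjoint A B)
    (h₁ : ∀ v ∈ A, ∀ w ∈ B, ¬ M₁.graph.Bidirected v w)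
    (h₂ : ∀ v ∈ A, ∀ w ∈ B, ¬ M₂.graph.Bidirected v w)
    (hunion : M₁.cFactor (A ∪ B) = M₂.cFactor (A ∪ B))
    (hpos : ∀ x, M₁.cFactor (A ∪ B) x ≠ 0) (hB : M₁.cFactor B = M₂.cFactor B) :
    M₁.cFactor A = M₂.cFactor A := by
  funext x
  have hx := congrFun hunion x
  have hne := hpos x
  rw [M₁.cFactor_union hAB h₁] at hx hne
  rw [M₂.cFactor_union hAB h₂, ← hB] at hx
  exact (ENNReal.mul_left_inj (right_ne_zero_of_mul hne)
    ((M₁.cFactor_le_one B x).trans_lt ENNReal.one_lt_top).ne).1 hx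

variable [Fintype V] [DecidableEq V]

theorem cFactor_ne_zero_of_ancestral [∀ v, Countable (S v)] (h : G.SameSemiMarkovian M.graph)
    (hpos : ∀ x, M.cFactor Finset.univ x ≠ 0) {A : Finset V} (hA : G.Ancestral A)
    (x : ∀ v, S v) : M.cFactor A x ≠ 0 := by
  revert x
  refine hA.induction_down (p := fun A => ∀ x, M.cFactor A x ≠ 0) hpos ?_
  intro A v hv hA _ ih x
  rw [← M.tsum_cFactor_insert hv (not_adj_of_ancestral h hA hv) x]
  exact fun h0 => ih _ (ENNReal.tsum_eq_zero.1 h0 (x v))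

/-- The observational distribution determines the c-factors of ancestral sets, since they are
its marginals. -/
theorem cFactor_eq_of_ancestral [∀ v, Countable (S v)] (h₁ : G.SameSemiMarkovian M₁.graph)
    (h₂ : G.SameSemiMarkovian M₂.graph)
    (hobs : M₁.cFactor Finset.univ = M₂.cFactor Finset.univ) {A : Finset V}
    (hA : G.Ancestral A) : M₁.cFactor A = M₂.cFactor A := by
  refine hA.induction_down (p := fun A => M₁.cFactor A = M₂.cFactor A) hobs ?_
  intro A v hv hA _ ih
  funext x
  rw [← M₁.tsum_cFactor_insert hv (not_adj_of_ancestral h₁ hA hv) x,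
    ← M₂.tsum_cFactor_insert hv (not_adj_of_ancestral h₂ hA hv) x, ih]

/-- If no bidirected edge joins the two parts `T` and `¬ T` of an ancestral set, a positive
observational distribution determines the c-factors of both parts. A variable added last in
topological order changes only the c-factor of its own part, which is the quotient of the
c-factor of the whole set by that of the other part. -/
theorem cFactor_filter_eq [∀ v, Countable (S v)] (h₁ : G.SameSemiMarkovian M₁.graph)
    (h₂ : G.SameSemiMarkovian M₂.graph)
    (hobs : M₁.cFactor Finset.univ = M₂.cFactor Finset.univ)
    (hpos : ∀ x, M₁.cFactor Finset.univ x ≠ 0) (T : V → Prop) [DecidablePred T]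
    {A : Finset V} (hA : G.Ancestral A)
    (hT : ∀ v ∈ A, ∀ w ∈ A, T v → ¬ T w → ¬ G.Bidirected v w) :
    M₁.cFactor (A.filter T) = M₂.cFactor (A.filter T) ∧
      M₁.cFactor (A.filter fun v => ¬ T v) = M₂.cFactor (A.filter fun v => ¬ T v) := by
  revert hT
  refine hA.induction_up (p := fun A => (∀ v ∈ A, ∀ w ∈ A, T v → ¬ T w → ¬ G.Bidirected v w) →
    M₁.cFactor (A.filter T) = M₂.cFactor (A.filter T) ∧
      M₁.cFactor (A.filter fun v => ¬ T v) = M₂.cFactor (A.filter fun v => ¬ T v)) ?_ ?_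
  · intro _
    simp [funext_iff, cFactor]
  intro A v hv _ hvA ih hT
  obtain ⟨ihT, ihN⟩ := ih fun a ha b hb =>
    hT a (Finset.mem_insert_of_mem ha) b (Finset.mem_insert_of_mem hb)
  have hall := cFactor_eq_of_ancestral h₁ h₂ hobs hvA
  have hne := cFactor_ne_zero_of_ancestral h₁ hpos hvA
  have hdisj := Finset.disjoint_filter_filter_not (insert v A) (insert v A) T
  have hun := Finset.filter_union_filter_not_eq T (insert v A)
  have hno : ∀ {M : SMCM.{uV, uS, uN, uL} V S}, G.SameSemiMarkovian M.graph →
      ∀ a ∈ (insert v A).filter T, ∀ b ∈ (insert v A).filter (fun v => ¬ T v),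
        ¬ M.graph.Bidirected a b := fun h a ha b hb hab =>
    hT a (Finset.mem_filter.1 ha).1 b (Finset.mem_filter.1 hb).1 (Finset.mem_filter.1 ha).2
      (Finset.mem_filter.1 hb).2 ((h.2 a b).2 hab)
  have hno' : ∀ {M : SMCM.{uV, uS, uN, uL} V S}, G.SameSemiMarkovian M.graph →
      ∀ b ∈ (insert v A).filter (fun v => ¬ T v), ∀ a ∈ (insert v A).filter T,
        ¬ M.graph.Bidirected b a := fun h b hb a ha hba =>
    hno h a ha b hb ⟨hba.1.symm, hba.2.imp fun _ => And.symm⟩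
  by_cases hTv : T v
  · have hN : (insert v A).filter (fun v => ¬ T v) = A.filter fun v => ¬ T v := by
      simp [Finset.filter_insert, hTv]
    have hN' : M₁.cFactor ((insert v A).filter fun v => ¬ T v) =
        M₂.cFactor ((insert v A).filter fun v => ¬ T v) := by rw [hN, ihN]
    exact ⟨cFactor_left_eq hdisj (hno h₁) (hno h₂) (by rw [hun, hall]) (by rwa [hun]) hN', hN'⟩
  · have hY : (insert v A).filter T = A.filter T := by simp [Finset.filter_insert, hTv]
    have hY' : M₁.cFactor ((insert v A).filter T) = M₂.cFactor ((insert v A).filter T) := by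
      rw [hY, ihT]
    rw [Finset.union_comm] at hun
    exact ⟨hY', cFactor_left_eq hdisj.symm (hno' h₁) (hno' h₂) (by rw [hun, hall])
      (by rwa [hun]) hY'⟩

/-- The causal effect is a sum of c-factors of `A \ {t}` for every ancestral set `A` that contains
`t` and `y`. The sum runs over the values of `A \ {t, y}`, encoded as the points that agree with a
base point `x₀` on all other coordinates. -/
theorem causalEffect_eq_tsum [∀ v, Countable (S v)] (h : G.SameSemiMarkovian M.graph) {t y : V}
    (x₀ : ∀ v, S v) {A : Finset V} (hA : G.Ancestral A) (ht : t ∈ A) (hy : y ∈ A) :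
    M.causalEffect t (x₀ t) y (x₀ y) =
      ∑' x : {x : ∀ v, S v // ∀ v, v ∉ A ∨ v = t ∨ v = y → x v = x₀ v},
        M.cFactor (A.erase t) x := by
  revert ht hy
  refine hA.induction_down (p := fun A => t ∈ A → y ∈ A → M.causalEffect t (x₀ t) y (x₀ y) =
      ∑' x : {x : ∀ v, S v // ∀ v, v ∉ A ∨ v = t ∨ v = y → x v = x₀ v},
        M.cFactor (A.erase t) x) ?_ ?_
  · intro _ _
    change ∑' x : ({x | x y = x₀ y} : Set (∀ v, S v)), Set.indicator {x | x t = x₀ t}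
        (M.cFactor (Finset.univ.erase t)) (x : ∀ v, S v) =
      ∑' x : ({x | ∀ v, v ∉ Finset.univ ∨ v = t ∨ v = y → x v = x₀ v} : Set (∀ v, S v)),
        M.cFactor (Finset.univ.erase t) x
    have hset : {x | x y = x₀ y} ∩ {x | x t = x₀ t} =
        {x : ∀ v, S v | ∀ v, v ∉ Finset.univ ∨ v = t ∨ v = y → x v = x₀ v} := by
      ext x
      simp only [Set.mem_inter_iff, Set.mem_ofPred_eq, Finset.mem_univ, not_true, false_or]
      exact ⟨fun hx v hv => by rcases hv with rfl | rfl; exacts [hx.2, hx.1],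
        fun hx => ⟨hx y (.inr rfl), hx t (.inl rfl)⟩⟩
    rw [tsum_subtype, tsum_subtype, Set.indicator_indicator, hset]
  · intro A v hv hA _ ih ht hy
    rw [ih (Finset.mem_insert_of_mem ht) (Finset.mem_insert_of_mem hy)]
    have hvt : v ≠ t := fun e => hv (e ▸ ht)
    have hvy : v ≠ y := fun e => hv (e ▸ hy)
    let e : {x : ∀ v, S v // ∀ w, w ∉ A ∨ w = t ∨ w = y → x w = x₀ w} × S v ≃
        {x : ∀ v, S v // ∀ w, w ∉ insert v A ∨ w = t ∨ w = y → x w = x₀ w} :=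
      { toFun := fun p => ⟨Function.update p.1.1 v p.2, fun w hw => by
          have hwv : w ≠ v := by rintro rfl; simp [hvt, hvy] at hw
          rw [Function.update_of_ne hwv]
          exact p.1.2 w (hw.imp_left fun h' h'' => h' (Finset.mem_insert_of_mem h''))⟩
        invFun := fun x => ⟨⟨Function.update x.1 v (x₀ v), fun w hw => by
          by_cases hwv : w = v
          · subst hwv; simp
          · rw [Function.update_of_ne hwv]
            exact x.2 w (hw.imp_left (by simp [hwv]))⟩, x.1 v⟩
        left_inv := fun p => by
          have := p.1.2 v (.inl hv)
          refine Prod.ext (Subtype.ext ?_) (by simp)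
          simp [← this]
        right_inv := fun x => Subtype.ext (by simp) }
    rw [← e.tsum_eq, ENNReal.tsum_prod']
    refine tsum_congr fun x => ?_
    rw [← M.tsum_cFactor_insert (v := v) (fun h' => hv (Finset.mem_of_mem_erase h'))
      (fun w hw => not_adj_of_ancestral h hA hv w (Finset.mem_of_mem_erase hw)) x.1,
      ← Finset.erase_insert_of_ne hvt]
    rfl

end SMCM

/-! ### Identifiability -/

theorem theorem1 {V : Type uV} [Fintype V] [DecidableEq V] {U : Type uU}
    {S : V → Type uS} [∀ v, Countable (S v)]
    (G : CausalGraph V U) (t y : V) (B : Set V)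
    (P : PMF (∀ v, S v)) (hP : ∀ x, 0 < P x)
    (hdesc : G.IsDescendant (Sum.inl y) (Sum.inl t))
    (hconf : G.Bidirected t y)
    (hB : B = G.children t)
    (hsep : ∃ Z : Set V, Z ⊆ (B ∪ {t, y})ᶜ ∧
      G.DSep (Sum.inl '' B) {Sum.inl y} (Sum.inl '' (insert t Z))) :
    Identifiable.{uV, uU, uS, uN, uL} G P t y := by
  classical
  intro M₁ M₂ h₁ h₂ hobs₁ hobs₂ t₀ y₀
  obtain ⟨Z, -, hsep⟩ := hsep
  obtain ⟨x, -⟩ := P.support_nonempty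
  obtain ⟨x₀, rfl, rfl⟩ : ∃ x₀ : ∀ v, S v, x₀ t = t₀ ∧ x₀ y = y₀ :=
    ⟨Function.update (Function.update x t t₀) y y₀, by simp [Function.update_of_ne hconf.1],
      by simp⟩
  have hobs : M₁.cFactor Finset.univ = M₂.cFactor Finset.univ :=
    funext fun x => (hobs₁ x).trans (hobs₂ x).symm
  have hpos : ∀ x, M₁.cFactor Finset.univ x ≠ 0 := fun x =>
    ((hP x).trans_eq (hobs₁ x).symm).ne'
  -- the ancestors of `y`
  let D : Finset V :=
    Finset.univ.filter fun v => Relation.ReflTransGen G.Adj (Sum.inl v) (Sum.inl y)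
  have hD : G.Ancestral D := fun w hw v hvw => by
    simp only [D, Finset.mem_filter, Finset.mem_univ, true_and] at hw ⊢
    exact .head hvw hw
  have htD : t ∈ D := by simpa [D] using hdesc.to_reflTransGen
  have hyD : y ∈ D := by simp [D, Relation.ReflTransGen.refl]
  -- membership in the c-component of `t` among the ancestors of `y`
  let T : V → Prop := Relation.ReflTransGen (fun a b => G.Bidirected a b ∧
    Relation.ReflTransGen G.Adj (Sum.inl a) (Sum.inl y)) t
  have hT : ∀ v ∈ D, ∀ w ∈ D, T v → ¬ T w → ¬ G.Bidirected v w := fun v hv w _ hTv hTw hvw =>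
    hTw (.tail hTv ⟨hvw, (Finset.mem_filter.1 hv).2⟩)
  have hchild : ∀ v, T v → ¬ G.Adj (Sum.inl t) (Sum.inl v) := by
    intro v hv htv
    obtain ⟨q, L, -, hL, hy⟩ :=
      CausalGraph.exists_activeWalk_of_bidirected (C := insert t Z) hconf hv
    exact hsep.not_activeWalk ⟨v, hB ▸ htv, rfl⟩ rfl rfl (L := Sum.inl v :: Sum.inr q :: L)
      (by simpa [List.getLast?_cons_cons] using hy) hL
  obtain ⟨hcT, hcN⟩ := SMCM.cFactor_filter_eq h₁ h₂ hobs hpos T hD hT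
  have hsplit : D.erase t = (D.filter T).erase t ∪ D.filter fun v => ¬ T v := by
    ext v
    by_cases hv : v = t
    · subst hv; simp [T, Relation.ReflTransGen.refl]
    · simp only [Finset.mem_erase, Finset.mem_union, Finset.mem_filter]; tauto
  have htT : insert t ((D.filter T).erase t) = D.filter T :=
    Finset.insert_erase (Finset.mem_filter.2 ⟨htD, .refl⟩)
  have hsum : ∀ M : SMCM.{uV, uS, uN, uL} V S, G.SameSemiMarkovian M.graph → ∀ x,
      M.cFactor (D.erase t) x = (∑' a, M.cFactor (D.filter T) (Function.update x t a)) *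
        M.cFactor (D.filter fun v => ¬ T v) x := by
    intro M h x
    rw [hsplit, M.cFactor_union, ← M.tsum_cFactor_insert (Finset.notMem_erase t (D.filter T)),
      htT]
    · exact fun w hw hadj => hchild w (Finset.mem_filter.1 (Finset.mem_of_mem_erase hw)).2
        ((h.1 t w).2 hadj)
    · exact (Finset.disjoint_filter_filter_not D D T).mono_left (Finset.erase_subset _ _)
    · intro v hv w hw hvw
      have hv := Finset.mem_filter.1 (Finset.mem_of_mem_erase hv)
      have hw := Finset.mem_filter.1 hw
      exact hT v hv.1 w hw.1 hv.2 hw.2 ((h.2 v w).2 hvw)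
  rw [SMCM.causalEffect_eq_tsum h₁ x₀ hD htD hyD, SMCM.causalEffect_eq_tsum h₂ x₀ hD htD hyD]
  exact tsum_congr fun x => by rw [hsum M₁ h₁, hsum M₂ h₂, hcT, hcN]
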